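/- All graphs are finite, simple and undirected. For graphs $G_1$ and $G_2$, the neighborhood corona $G_1\bigstar G_2$ is the graph with vertex set $V(G_1)\times(V(G_2)\cup\{0\})$, where $0\notin V(G_2)$, in which $(x,y)$ and $(x',y')$ are adjacent if and only if (a) $y=y'=0$ and $xx'\in E(G_1)$, or (b) $x=x'$, $y,y'\in V(G_2)$ and $yy'\in E(G_2)$, or (c) $xx'\in E(G_1)$ and exactly one of $y,y'$ is $0$. For a graph $G$ with adjacency matrix $A(G)$ let $H_G(t)=\exp(-\mathrm{i}tA(G))$, and let $e_x$ be the standard basis vector indexed by the vertex $x$. The graph $G$ is periodic at $x$ if $H_G(t)e_x=c\,e_x$ for some real $t>0$ and some $c\in\mathbb{C}$ with $|c|=1$. It has perfect state transfer if $H_G(t)e_x=c\,e_y$ for some distinct vertices $x,y$, some real $t>0$ and some $c\in\mathbb{C}$ with $|c|=1$. A graph is integral if all eigenvalues of its adjacency matrix are integers. **Theorem 4.4.** Let $G_1$ be an $r$-regular connected integral graph and let $G_2$ be a (not necessarily connected) $k$-regular graph on $n_2$ vertices. If $\sqrt{(r-k)^2+4n_2r^2}$ is not an integer, then $G_1\bigstar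 G_2$ is not periodic at $(v,w)$ for any $v\in V(G_1)$ and any $w\in V(G_2)\cup\{0\}$. Moreover, $G_1\bigstar G_2$ has no perfect state transfer. -/

import Mathlib

/-- The neighborhood corona `G₁ ★ G₂`, on the vertex set `V₁ × (V₂ ∪ {0})`; the extra symbol `0`
is `none : Option V₂`. The vertices `(x, none)` span the copy of `G₁`, the vertices `(x, some w)`
with `x` fixed span the copy of `G₂` that belongs to `x`, and every vertex of that copy is joined
to the neighbors of `x` in `G₁`. -/
def neighborhoodCorona {V₁ V₂ : Type*} (G₁ : SimpleGraph V₁) (G₂ : SimpleGraph V₂) :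
    SimpleGraph (V₁ × Option V₂) where
  Adj p q :=
    (p.2 = none ∧ q.2 = none ∧ G₁.Adj p.1 q.1) ∨
    (p.1 = q.1 ∧ ∃ w w' : V₂, p.2 = some w ∧ q.2 = some w' ∧ G₂.Adj w w') ∨
    (G₁.Adj p.1 q.1 ∧ ((p.2 = none ∧ q.2 ≠ none) ∨ (p.2 ≠ none ∧ q.2 = none)))
  symm := by
    constructor
    rintro p q (⟨h1, h2, h3⟩ | ⟨h1, w, w', h2, h3, h4⟩ | ⟨h1, h2⟩)
    · exact Or.inl ⟨h2, h1, h3.symm⟩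
    · exact Or.inr (Or.inl ⟨h1.symm, w', w, h3, h2, h4.symm⟩)
    · exact Or.inr (Or.inr ⟨h1.symm, h2.symm.imp And.symm And.symm⟩)
  loopless := by
    constructor
    rintro p (⟨_, _, h⟩ | ⟨_, w, w', h2, h3, h4⟩ | ⟨h, _⟩)
    · exact G₁.loopless.irrefl _ h
    · rw [h2] at h3
      cases h3
      exact G₂.loopless.irrefl _ h4
    · exact G₁.loopless.irrefl _ h

instance neighborhoodCorona.decidableAdj {V₁ V₂ : Type*} [DecidableEq V₁] [DecidableEq V₂]
    [Fintype V₂] (G₁ : SimpleGraph V₁) (G₂ : SimpleGraph V₂)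
    [DecidableRel G₁.Adj] [DecidableRel G₂.Adj] :
    DecidableRel (neighborhoodCorona G₁ G₂).Adj := fun p q =>
  inferInstanceAs (Decidable
    ((p.2 = none ∧ q.2 = none ∧ G₁.Adj p.1 q.1) ∨
    (p.1 = q.1 ∧ ∃ w w' : V₂, p.2 = some w ∧ q.2 = some w' ∧ G₂.Adj w w') ∨
    (G₁.Adj p.1 q.1 ∧ ((p.2 = none ∧ q.2 ≠ none) ∨ (p.2 ≠ none ∧ q.2 = none)))))

/-- A finite graph is integral if every eigenvalue of its adjacency matrix is an integer. (The
matrix is real symmetric, so that all its eigenvalues are real.) -/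
def IsIntegralGraph {V : Type*} [Fintype V] [DecidableEq V] (G : SimpleGraph V)
    [DecidableRel G.Adj] : Prop :=
  ∀ μ : ℝ, Module.End.HasEigenvalue (Matrix.toLin' (G.adjMatrix ℝ)) μ → ∃ z : ℤ, μ = (z : ℝ)

/-- The transition matrix `exp(-itA(G))` of the continuous-time quantum walk on `G`. -/
noncomputable def transitionMatrix {V : Type*} [Fintype V] [DecidableEq V] (G : SimpleGraph V)
    [DecidableRel G.Adj] (t : ℝ) : Matrix V V ℂ :=
  NormedSpace.exp ((-(Complex.I * (t : ℂ))) • G.adjMatrix ℂ)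

/-- At time `t` the walk carries `e_x` to a unit complex multiple of `e_y`:
`exp(-itA(G)) e_x = c e_y` with `|c| = 1`. -/
def TransfersAt {V : Type*} [Fintype V] [DecidableEq V] (G : SimpleGraph V)
    [DecidableRel G.Adj] (x y : V) (t : ℝ) : Prop :=
  ∃ c : ℂ, ‖c‖ = 1 ∧
    Matrix.mulVec (transitionMatrix G t) (Pi.single x (1 : ℂ)) = c • (Pi.single y (1 : ℂ) : V → ℂ)

/-- `G` is periodic at the vertex `x`: at some time `t > 0` the walk returns from `x` to `x`. -/
def IsPeriodicAt {V : Type*} [Fintype V] [DecidableEq V] (G : SimpleGraph V)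
    [DecidableRel G.Adj] (x : V) : Prop :=
  ∃ t : ℝ, 0 < t ∧ TransfersAt G x x t

/-- `G` admits perfect state transfer: between some two distinct vertices at some time `t > 0`. -/
def AdmitsPST {V : Type*} [Fintype V] [DecidableEq V] (G : SimpleGraph V)
    [DecidableRel G.Adj] : Prop :=
  ∃ x y : V, x ≠ y ∧ ∃ t : ℝ, 0 < t ∧ TransfersAt G x y t

/-! If the walk carries `e_x` to `c e_y`, every eigenvalue θ in the support of `x` satisfies
exp(-itθ) = ±c, so differences of such eigenvalues are integer multiples of π/t and have rational
ratios. Periodicity is the case x = y, so one obstruction settles both claims. An eigenvalue l ≠ 0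
of `G₁` supported at v yields two corona eigenvalues (l + k ± s_l)/2 supported at every (v, w). For
l = r their difference is s_r, the square root in the hypothesis. Since A(G₁) has zero diagonal, v
also supports a negative eigenvalue z, an integer by integrality. Subtracting the pair of z from
that of r and adding cancels both square roots and leaves r - z > 0. Hence s_r is rational; its
square is an integer, so s_r is an integer, a contradiction. -/

open Matrix in
/-- An eigenvector of a matrix is an eigenvector of its exponential. -/
theorem Matrix.exp_mulVec_of_mulVec_eq_smul {n : Type*} [Fintype n] [DecidableEq n]
    {A : Matrix n n ℂ} {u : n → ℂ} {a : ℂ} (h : A *ᵥ u = a • u) :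
    NormedSpace.exp A *ᵥ u = Complex.exp a • u := by
  let : NormedRing (Matrix n n ℂ) := Matrix.linftyOpNormedRing
  let : NormedAlgebra ℂ (Matrix n n ℂ) := Matrix.linftyOpNormedAlgebra
  have hpow : ∀ m : ℕ, A ^ m *ᵥ u = a ^ m • u := by
    intro m
    induction m with
    | zero => simp
    | succ m ih => rw [pow_succ, ← mulVec_mulVec, h, mulVec_smul, ih, smul_smul, pow_succ']
  have h1 : HasSum (fun m : ℕ => ((m.factorial : ℂ)⁻¹ • A ^ m) *ᵥ u)
      (NormedSpace.exp A *ᵥ u) :=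
    (NormedSpace.exp_series_hasSum_exp' (𝕂 := ℂ) A).map
      ((Matrix.mulVecBilin ℂ ℂ).flip u) (by
        change Continuous fun M : Matrix n n ℂ => M *ᵥ u
        fun_prop)
  have h2 : HasSum (fun m : ℕ => ((m.factorial : ℂ)⁻¹ • a ^ m) • u) (Complex.exp a • u) := by
    rw [Complex.exp_eq_exp_ℂ]
    exact (NormedSpace.exp_series_hasSum_exp' (𝕂 := ℂ) a).smul_const u
  refine h1.unique (h2.congr_fun ?_)
  intro m
  rw [smul_mulVec, hpow, smul_assoc]

open Matrix in
/-- If the walk carries `e_x` to `c e_y`, then every eigenvector `u` satisfies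
`exp(-itθ) u x = c u y`. -/
theorem exp_mul_apply_eq_of_transfer {V : Type*} [Fintype V] [DecidableEq V] {G : SimpleGraph V}
    [DecidableRel G.Adj] {x y : V} {t : ℝ} {c : ℂ}
    (h : transitionMatrix G t *ᵥ Pi.single x (1 : ℂ) = c • (Pi.single y (1 : ℂ) : V → ℂ))
    {u : V → ℝ} {θ : ℝ} (hu : G.adjMatrix ℝ *ᵥ u = θ • u) :
    Complex.exp (-(Complex.I * t) * θ) * u x = c * u y := by
  have huc : G.adjMatrix ℂ *ᵥ (fun z => (u z : ℂ)) = (θ : ℂ) • fun z => (u z : ℂ) := by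
    ext z
    have := congrFun hu z
    simp only [SimpleGraph.adjMatrix_mulVec_apply, Pi.smul_apply, smul_eq_mul] at this ⊢
    exact_mod_cast this
  have hexp : transitionMatrix G t *ᵥ (fun z => (u z : ℂ)) =
      Complex.exp (-(Complex.I * t) * θ) • fun z => (u z : ℂ) := by
    refine Matrix.exp_mulVec_of_mulVec_eq_smul ?_
    rw [smul_mulVec, huc, smul_smul]
  have hsymm : (transitionMatrix G t)ᵀ = transitionMatrix G t := by
    rw [transitionMatrix, ← Matrix.exp_transpose, transpose_smul, SimpleGraph.transpose_adjMatrix]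
  -- Pair with `u`, and move the symmetric transition matrix onto it.
  have key := congrArg (fun w => (fun z => (u z : ℂ)) ⬝ᵥ w) h
  simp only [dotProduct_mulVec] at key
  rw [← mulVec_transpose, hsymm, hexp] at key
  simpa using key

open Matrix in
/-- If the walk carries `e_x` to `c e_y`, then `exp(-itθ) = ± c` for every eigenvalue `θ` in the
eigenvalue support of `x`. -/
theorem exp_sq_eq_of_transfer {V : Type*} [Fintype V] [DecidableEq V] {G : SimpleGraph V}
    [DecidableRel G.Adj] {x y : V} {t : ℝ} {c : ℂ} (hc : ‖c‖ = 1)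
    (h : transitionMatrix G t *ᵥ Pi.single x (1 : ℂ) = c • (Pi.single y (1 : ℂ) : V → ℂ))
    {u : V → ℝ} {θ : ℝ} (hu : G.adjMatrix ℝ *ᵥ u = θ • u) (hx : u x ≠ 0) :
    Complex.exp (-(Complex.I * t) * θ) ^ 2 = c ^ 2 := by
  have key := exp_mul_apply_eq_of_transfer h hu
  have hn : |u x| = |u y| := by
    have h1 := congrArg norm key
    have h2 : ‖Complex.exp (-(Complex.I * t) * θ)‖ = 1 := by simp [Complex.norm_exp]
    rwa [norm_mul, norm_mul, h2, hc, one_mul, one_mul, Complex.norm_real, Complex.norm_real] at h1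
  have hsq : (u x : ℂ) ^ 2 = (u y : ℂ) ^ 2 := by exact_mod_cast (sq_eq_sq_iff_abs_eq_abs _ _).2 hn
  have hx' : (u x : ℂ) ^ 2 ≠ 0 := pow_ne_zero 2 (by exact_mod_cast hx)
  apply mul_right_cancel₀ hx'
  rw [← mul_pow, key, mul_pow, hsq]

open Matrix in
/-- Any two eigenvalues in the eigenvalue support of `x` differ by a multiple of `π / t`. -/
theorem exists_int_mul_sub_eq_of_transfersAt {V : Type*} [Fintype V] [DecidableEq V]
    {G : SimpleGraph V} [DecidableRel G.Adj] {x y : V} {t : ℝ} (h : TransfersAt G x y t)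
    {u u' : V → ℝ} {θ θ' : ℝ} (hu : G.adjMatrix ℝ *ᵥ u = θ • u) (hx : u x ≠ 0)
    (hu' : G.adjMatrix ℝ *ᵥ u' = θ' • u') (hx' : u' x ≠ 0) :
    ∃ m : ℤ, t * (θ - θ') = m * Real.pi := by
  obtain ⟨c, hc, h⟩ := h
  have key := (exp_sq_eq_of_transfer hc h hu hx).trans (exp_sq_eq_of_transfer hc h hu' hx').symm
  -- Squaring removed the sign, so the period 2πi now determines tθ modulo π.
  rw [← Complex.exp_nat_mul, ← Complex.exp_nat_mul, Complex.exp_eq_exp_iff_exists_int] at key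
  obtain ⟨m, hm⟩ := key
  refine ⟨-m, ?_⟩
  have h2 : (2 * Complex.I) * ((t * (θ - θ') : ℝ) : ℂ) =
      (2 * Complex.I) * (((-m : ℤ) * Real.pi : ℝ) : ℂ) := by
    push_cast at hm ⊢
    linear_combination -hm
  exact_mod_cast mul_left_cancel₀ (by simp) h2

open Matrix in
/-- A vertex with a neighbor has a negative eigenvalue in its eigenvalue support. -/
theorem SimpleGraph.exists_neg_eigenvector_apply_ne_zero {V : Type*} [Fintype V] [DecidableEq V]
    (G : SimpleGraph V) [DecidableRel G.Adj] {v w : V} (hvw : G.Adj v w) :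
    ∃ (l : ℝ) (X : V → ℝ), l < 0 ∧ G.adjMatrix ℝ *ᵥ X = l • X ∧ X v ≠ 0 := by
  have hA : (G.adjMatrix ℝ).IsHermitian := by
    rw [Matrix.IsHermitian, conjTranspose_eq_transpose_of_trivial, transpose_adjMatrix]
  set b := hA.eigenvectorBasis with hb
  have hmul := hA.mulVec_eigenvectorBasis
  by_contra! hcon
  have hnonneg : ∀ i, b i v ≠ 0 → 0 ≤ hA.eigenvalues i := fun i hi =>
    le_of_not_gt fun hlt => hi (hcon _ _ hlt (hmul i))
  have hcol : ∀ i, inner ℝ (b i) (WithLp.toLp 2 ((G.adjMatrix ℝ).col v)) =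
      hA.eigenvalues i * b i v := by
    intro i
    have h1 := congrFun (hmul i) v
    simp only [Pi.smul_apply, smul_eq_mul] at h1
    rw [← h1, PiLp.inner_apply]
    simp only [mulVec, dotProduct, Matrix.col_apply]
    refine Finset.sum_congr rfl fun j _ => ?_
    simp [SimpleGraph.adjMatrix_apply, G.adj_comm, hb]
  -- Parseval writes the diagonal entry A_vv = 0 as the sum of λ_i b_i(v)². With no negative term
  -- all terms vanish, so column v is zero, although v has the neighbor `w`.
  have hsum := b.sum_inner_mul_inner (EuclideanSpace.single v (1 : ℝ))
    (WithLp.toLp 2 ((G.adjMatrix ℝ).col v))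
  simp only [hcol, EuclideanSpace.inner_single_left, map_one, one_mul, Matrix.col_apply,
    SimpleGraph.adjMatrix_apply, SimpleGraph.irrefl, if_false] at hsum
  have hterm : ∀ i, hA.eigenvalues i * b i v = 0 := by
    intro i
    have hz := (Finset.sum_eq_zero_iff_of_nonneg (fun i _ => by
      by_cases hi : b i v = 0
      · simp [hi]
      · have := mul_nonneg (hnonneg i hi) (mul_self_nonneg (b i v))
        linarith)).1 hsum i (Finset.mem_univ i)
    rcases mul_eq_zero.1 hz with h | h
    · simp [h]
    · exact h
  have hzero : WithLp.toLp 2 ((G.adjMatrix ℝ).col v) = 0 := by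
    rw [← b.sum_repr' (WithLp.toLp 2 ((G.adjMatrix ℝ).col v))]
    simp [hcol, hterm]
  have := congrArg (fun f : EuclideanSpace ℝ V => f w) hzero
  simp [hvw.symm] at this

/-- The lift of a function on `V₁` to the neighborhood corona that takes the value `a X` on the copy
of `G₁` and `b X` on the copies of `G₂`. -/
def neighborhoodCoronaLift {V₁ V₂ : Type*} (a b : ℝ) (X : V₁ → ℝ) : V₁ × Option V₂ → ℝ
  | (x, none) => a * X x
  | (x, some _) => b * X x

open Matrix in
/-- Lifts of eigenvectors of `G₁` are eigenvectors of the neighborhood corona. -/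
theorem neighborhoodCorona_mulVec_lift {V₁ V₂ : Type*} [Fintype V₁] [DecidableEq V₁] [Fintype V₂]
    [DecidableEq V₂] {G₁ : SimpleGraph V₁} [DecidableRel G₁.Adj] {G₂ : SimpleGraph V₂}
    [DecidableRel G₂.Adj] {k : ℕ} (hreg₂ : G₂.IsRegularOfDegree k) {X : V₁ → ℝ} {l θ : ℝ}
    (hX : G₁.adjMatrix ℝ *ᵥ X = l • X) (hθ : (θ - l) * (θ - k) = Fintype.card V₂ * l ^ 2) :
    (neighborhoodCorona G₁ G₂).adjMatrix ℝ *ᵥ neighborhoodCoronaLift (θ - k) l X =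
      θ • neighborhoodCoronaLift (θ - k) l X := by
  have hX' : ∀ x, ∑ y, (if G₁.Adj x y then X y else 0) = l * X x := by
    intro x
    simpa [mulVec, dotProduct, SimpleGraph.adjMatrix_apply] using congrFun hX x
  have hk : ∀ w, ∑ z, (if G₂.Adj w z then (1 : ℝ) else 0) = k := by
    intro w
    rw [← hreg₂.degree_eq w, ← SimpleGraph.card_neighborFinset_eq_degree]
    simp [SimpleGraph.neighborFinset_eq_filter]
  ext ⟨x, w⟩
  simp only [mulVec, dotProduct, SimpleGraph.adjMatrix_apply, Fintype.sum_prod_type,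
    Fintype.sum_option, Pi.smul_apply, smul_eq_mul]
  rcases w with _ | w
  · have h1 : ∀ y, (neighborhoodCorona G₁ G₂).Adj (x, none) (y, none) ↔ G₁.Adj x y := by
      simp [neighborhoodCorona]
    have h2 : ∀ y z, (neighborhoodCorona G₁ G₂).Adj (x, none) (y, some z) ↔ G₁.Adj x y := by
      simp [neighborhoodCorona]
    simp only [h1, h2, neighborhoodCoronaLift, Finset.sum_const, Finset.card_univ, nsmul_eq_mul]
    have h3 : ∀ y, (if G₁.Adj x y then (1 : ℝ) else 0) * ((θ - k) * X y) +
        Fintype.card V₂ * ((if G₁.Adj x y then (1 : ℝ) else 0) * (l * X y)) =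
        (θ - k + Fintype.card V₂ * l) * (if G₁.Adj x y then X y else 0) := by
      intro y
      split_ifs <;> ring
    rw [Finset.sum_congr rfl fun y _ => h3 y, ← Finset.mul_sum, hX']
    -- Only these rows need the quadratic; the choice of coefficients θ - k and l makes the rows in
    -- the copies of `G₂` identities.
    linear_combination -X x * hθ
  · have h1 : ∀ y, (neighborhoodCorona G₁ G₂).Adj (x, some w) (y, none) ↔ G₁.Adj x y := by
      simp [neighborhoodCorona]
    have h2 : ∀ y z, (neighborhoodCorona G₁ G₂).Adj (x, some w) (y, some z) ↔
        x = y ∧ G₂.Adj w z := by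
      simp [neighborhoodCorona]
    simp only [h1, h2, neighborhoodCoronaLift, ← Finset.sum_mul]
    have h3 : ∀ y, (if G₁.Adj x y then (1 : ℝ) else 0) * ((θ - k) * X y) +
        (∑ z, if x = y ∧ G₂.Adj w z then (1 : ℝ) else 0) * (l * X y) =
        (θ - k) * (if G₁.Adj x y then X y else 0) + if x = y then k * (l * X y) else 0 := by
      intro y
      by_cases hxy : x = y
      · subst hxy
        simp [hk]
      · by_cases h : G₁.Adj x y <;> simp [hxy, h]
    rw [Finset.sum_congr rfl fun y _ => h3 y, Finset.sum_add_distrib, ← Finset.mul_sum, hX']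
    simp
    ring

open Matrix in
/-- The two roots of `(θ - l)(θ - k) = n l²` attached to an eigenvalue `l ≠ 0` in the support of
`x` in `G₁` lie in the support of every vertex `(x, w)` of the neighborhood corona. -/
theorem neighborhoodCorona_exists_eigenvector {V₁ V₂ : Type*} [Fintype V₁] [DecidableEq V₁]
    [Fintype V₂] [DecidableEq V₂] {G₁ : SimpleGraph V₁} [DecidableRel G₁.Adj] {G₂ : SimpleGraph V₂}
    [DecidableRel G₂.Adj] {k : ℕ} (hreg₂ : G₂.IsRegularOfDegree k)
    (hcard : Fintype.card V₂ ≠ 0) {X : V₁ → ℝ} {l θ : ℝ} (hl : l ≠ 0)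
    (hX : G₁.adjMatrix ℝ *ᵥ X = l • X) (hθ : (θ - l) * (θ - k) = Fintype.card V₂ * l ^ 2)
    {p : V₁ × Option V₂} (hp : X p.1 ≠ 0) :
    ∃ u : V₁ × Option V₂ → ℝ, (neighborhoodCorona G₁ G₂).adjMatrix ℝ *ᵥ u = θ • u ∧ u p ≠ 0 := by
  refine ⟨_, neighborhoodCorona_mulVec_lift hreg₂ hX hθ, ?_⟩
  have hθk : θ - k ≠ 0 := by
    intro h0
    rw [h0, mul_zero] at hθ
    exact mul_ne_zero (Nat.cast_ne_zero.2 hcard) (pow_ne_zero 2 hl) hθ.symm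
  obtain ⟨x, _ | w⟩ := p
  · exact mul_ne_zero hθk hp
  · exact mul_ne_zero hl hp

/-- Both roots `θ` of `(θ - l)(θ - k) = n l²`. -/
theorem sub_mul_sub_eq_of_sqrt {l k n s : ℝ} (hn : 0 ≤ n)
    (hs : s = √((l - k) ^ 2 + 4 * n * l ^ 2)) :
    ((l + k + s) / 2 - l) * ((l + k + s) / 2 - k) = n * l ^ 2 ∧
      ((l + k - s) / 2 - l) * ((l + k - s) / 2 - k) = n * l ^ 2 := by
  have hsq : s ^ 2 = (l - k) ^ 2 + 4 * n * l ^ 2 := by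
    rw [hs, Real.sq_sqrt (by positivity)]
  constructor <;> linear_combination hsq / 4

theorem neighborhoodCorona_not_transfersAt {V₁ V₂ : Type*} [Fintype V₁] [DecidableEq V₁]
    [Fintype V₂] [DecidableEq V₂]
    (G₁ : SimpleGraph V₁) [DecidableRel G₁.Adj] (G₂ : SimpleGraph V₂) [DecidableRel G₂.Adj]
    {r k n₂ : ℕ} (hreg₁ : G₁.IsRegularOfDegree r) (hint : IsIntegralGraph G₁)
    (hreg₂ : G₂.IsRegularOfDegree k) (hn₂ : Fintype.card V₂ = n₂)
    (hsqrt : ¬ ∃ z : ℤ, √(((r : ℝ) - (k : ℝ)) ^ 2 + 4 * (n₂ : ℝ) * (r : ℝ) ^ 2) = (z : ℝ))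
    (p q : V₁ × Option V₂) {t : ℝ} (ht : 0 < t) :
    ¬ TransfersAt (neighborhoodCorona G₁ G₂) p q t := by
  intro h
  -- For r = 0 the root is k, and for n₂ = 0 it is |r - k|: both are integers.
  have hr : r ≠ 0 := by
    rintro rfl
    exact hsqrt ⟨k, by simp⟩
  have hcard : Fintype.card V₂ ≠ 0 := by
    intro h0
    refine hsqrt ⟨|(r : ℤ) - k|, ?_⟩
    rw [← hn₂, h0]
    simp [Real.sqrt_sq_eq_abs]
  subst hn₂
  obtain ⟨w, hw⟩ : ∃ w, G₁.Adj p.1 w := by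
    rw [← SimpleGraph.degree_pos_iff_exists_adj, hreg₁.degree_eq]
    exact Nat.pos_of_ne_zero hr
  obtain ⟨l, X, hl, hX, hXp⟩ := G₁.exists_neg_eigenvector_apply_ne_zero hw
  obtain ⟨z, rfl⟩ := hint l (Module.End.hasEigenvalue_of_hasEigenvector
    (x := X) ⟨Module.End.mem_eigenspace_iff.2 (by simpa using hX), fun h0 => hXp (by simp [h0])⟩)
  have hone : (G₁.adjMatrix ℝ).mulVec (fun _ => 1) = (r : ℝ) • fun _ => 1 := by
    ext x
    simp [SimpleGraph.adjMatrix_mulVec_apply, hreg₁.degree_eq]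
  have hr' : (r : ℝ) ≠ 0 := Nat.cast_ne_zero.2 hr
  have hn0 : (0 : ℝ) ≤ Fintype.card V₂ := Nat.cast_nonneg _
  set s := √(((r : ℝ) - (k : ℝ)) ^ 2 + 4 * (Fintype.card V₂ : ℝ) * (r : ℝ) ^ 2) with hs
  obtain ⟨h1, h2⟩ := sub_mul_sub_eq_of_sqrt hn0 hs
  obtain ⟨h3, h4⟩ := sub_mul_sub_eq_of_sqrt (l := (z : ℝ)) (k := k) hn0 rfl
  obtain ⟨u1, hu1, hp1⟩ := neighborhoodCorona_exists_eigenvector hreg₂ hcard hr' hone h1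
    (p := p) one_ne_zero
  obtain ⟨u2, hu2, hp2⟩ := neighborhoodCorona_exists_eigenvector hreg₂ hcard hr' hone h2
    (p := p) one_ne_zero
  obtain ⟨u3, hu3, hp3⟩ := neighborhoodCorona_exists_eigenvector hreg₂ hcard hl.ne hX h3 hXp
  obtain ⟨u4, hu4, hp4⟩ := neighborhoodCorona_exists_eigenvector hreg₂ hcard hl.ne hX h4 hXp
  obtain ⟨a, ha⟩ := exists_int_mul_sub_eq_of_transfersAt h hu1 hp1 hu2 hp2
  obtain ⟨b, hb⟩ := exists_int_mul_sub_eq_of_transfersAt h hu1 hp1 hu3 hp3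
  obtain ⟨c, hc⟩ := exists_int_mul_sub_eq_of_transfersAt h hu2 hp2 hu4 hp4
  -- The + and - roots of z enter only through their sum z + k, so the square root attached to z,
  -- possibly irrational, drops out of `htr`.
  have hts : t * s = a * Real.pi := by linear_combination ha
  have htr : t * (r - z) = (b + c) * Real.pi := by linear_combination hb + hc
  have hrz : (0 : ℝ) < r - z := by
    have : (0 : ℝ) ≤ r := Nat.cast_nonneg r
    linarith
  have hbc : ((b : ℝ) + c) ≠ 0 := by
    intro h0
    rw [h0, zero_mul] at htr
    exact (mul_pos ht hrz).ne' htr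
  have hrat : s = a * (r - z) / (b + c) := by
    rw [eq_div_iff hbc]
    apply mul_left_cancel₀ (mul_pos ht Real.pi_pos).ne'
    linear_combination Real.pi * (b + c) * hts - a * Real.pi * htr
  have hirr : Irrational s := by
    refine irrational_nrt_of_notint_nrt 2
      (((r : ℤ) - k) ^ 2 + 4 * (Fintype.card V₂ : ℤ) * (r : ℤ) ^ 2) ?_ hsqrt two_pos
    rw [hs, Real.sq_sqrt (by positivity)]
    push_cast
    ring
  exact hirr ⟨(a * ((r : ℚ) - z) / (b + c)), by rw [hrat]; push_cast; ring⟩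

theorem theorem4p4 {V₁ V₂ : Type*} [Fintype V₁] [DecidableEq V₁] [Fintype V₂] [DecidableEq V₂]
    (G₁ : SimpleGraph V₁) [DecidableRel G₁.Adj] (G₂ : SimpleGraph V₂) [DecidableRel G₂.Adj]
    (r k n₂ : ℕ) (hconn : G₁.Connected) (hreg₁ : G₁.IsRegularOfDegree r)
    (hint : IsIntegralGraph G₁) (hreg₂ : G₂.IsRegularOfDegree k) (hn₂ : Fintype.card V₂ = n₂)
    (hsqrt : ¬ ∃ z : ℤ, Real.sqrt (((r : ℝ) - (k : ℝ)) ^ 2 + 4 * (n₂ : ℝ) * (r : ℝ) ^ 2) = (z : ℝ)) :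
    (∀ (v : V₁) (w : Option V₂), ¬ IsPeriodicAt (neighborhoodCorona G₁ G₂) (v, w)) ∧
      ¬ AdmitsPST (neighborhoodCorona G₁ G₂) := by
  refine ⟨?_, ?_⟩
  · rintro v w ⟨t, ht, h⟩
    exact neighborhoodCorona_not_transfersAt G₁ G₂ hreg₁ hint hreg₂ hn₂ hsqrt _ _ ht h
  · rintro ⟨x, y, -, t, ht, h⟩
    exact neighborhoodCorona_not_transfersAt G₁ G₂ hreg₁ hint hreg₂ hn₂ hsqrt _ _ ht h
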